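/- Let $\Gamma$ be a totally ordered abelian group, regarded as a discrete group, with positive cone $\Gamma^+=\{x\in\Gamma: x\ge 0\}$ and dual group $\widehat\Gamma$ (all homomorphisms $\lambda:\Gamma\to\mathbb T$, with the topology of pointwise convergence). Let $\mathcal A$ be a unital $C^*$-algebra. An action of $\Gamma^+$ on $\mathcal A$ is a family $\mathcal V=(\mathcal V_x)_{x\in\Gamma^+}$ of bounded positive linear maps $\mathcal A\to\mathcal A$ with $\mathcal V_0=\mathrm{Id}$ and $\mathcal V_{x+y}=\mathcal V_x\circ\mathcal V_y$. It is finely representable if there are a unital $C^*$-algebra $C$, a unital injective $*$-homomorphism $\sigma:\mathcal A\to C$ and a semigroup homomorphism $x\mapsto U_x$ from $\Gamma^+$ into $C$ such that each $U_x$ is a partial isometry, $\sigma(\mathcal V_x(a))=U_x\sigma(a)U_x^*$ and $U_x^*\sigma(a)U_x\in\sigma(\mathcal A)$ for all $a\in\mathcal A$, $x\in\Gamma^+$. A pair $(\mathcal V,\mathcal H)$ of actions is a complete interaction if for all $x,y\in\Gamma^+$ and $a,b\in\mathcal A$: $\mathcal V_x\mathcal H_x\mathcal V_x=\mathcal V_x$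 and $\mathcal H_x\mathcal V_x\mathcal H_x=\mathcal H_x$; $\mathcal V_x(ab)=\mathcal V_x(a)\mathcal V_x(b)$ if $a$ or $b$ lies in $\mathcal H_x(\mathcal A)$; $\mathcal H_x(ab)=\mathcal H_x(a)\mathcal H_x(b)$ if $a$ or $b$ lies in $\mathcal V_x(\mathcal A)$; $\mathcal H_x(\mathcal V_x(a))=\mathcal H_x(1)a\mathcal H_x(1)$ and $\mathcal V_x(\mathcal H_x(a))=\mathcal V_x(1)a\mathcal V_x(1)$; and $\mathcal H_y(1)\mathcal V_x(1)=\mathcal V_x(1)\mathcal H_y(1)$. Let $\mathcal V$ be a finely representable action of $\Gamma^+$ on $\mathcal A$ and let $\mathcal H$ be the action for which $(\mathcal V,\mathcal H)$ is a complete interaction. Let $\mathcal A\rtimes_{(\mathcal V,\mathcal H)}\Gamma$ be the crossed product, that is, the universal unital $C^*$-algebra generated by a copy of $\mathcal A$ and partial isometries $\hat U_x$, $x\in\Gamma^+$, subject to the relations $$\mathcal V_x(a)=\hat U_x a\hat U_x^*,\qquad \mathcal H_x(a)=\hat U_x^* a\hat U_x,\qquad \hat U_x\hat U_y=\hat U_{x+y}\qquad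 (a\in\mathcal A,\ x,y\in\Gamma^+).$$ Corollary 5.5. There is one and only one action of the dual group $\widehat\Gamma$ on $\mathcal A\rtimes_{(\mathcal V,\mathcal H)}\Gamma$ by $*$-automorphisms, $\lambda\mapsto\Phi_\lambda$, such that for all $\lambda\in\widehat\Gamma$ $$\Phi_\lambda(a)=a\quad(a\in\mathcal A),\qquad \Phi_\lambda(\hat U_x)=\lambda(x)\,\hat U_x\quad(x\in\Gamma^+).$$ This action is point-norm continuous: $\lambda\mapsto\Phi_\lambda(b)$ is continuous for every $b\in\mathcal A\rtimes_{(\mathcal V,\mathcal H)}\Gamma$. -/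

import Mathlib

open Topology

universe u v w

namespace InteractionCrossedProduct

/-- The positive cone `Γ⁺ = {x ∈ Γ : 0 ≤ x}` of an ordered abelian group. -/
abbrev PosCone (Γ : Type v) [AddCommGroup Γ] [LinearOrder Γ] [IsOrderedAddMonoid Γ] : Type v :=
  {x : Γ // 0 ≤ x}

set_option linter.unusedSectionVars false

section Interactions

variable (A : Type u) (Γ : Type v) [CStarAlgebra A] [PartialOrder A] [StarOrderedRing A]
  [AddCommGroup Γ] [LinearOrder Γ] [IsOrderedAddMonoid Γ]

/-- An action of `Γ⁺` on `A`: a semigroup homomorphism `x ↦ 𝒱ₓ` (sending `0` to the identity)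
into the bounded positive linear maps of `A`. -/
structure PosAction where
  map : PosCone Γ → A →L[ℂ] A
  map_nonneg : ∀ x a, 0 ≤ a → 0 ≤ map x a
  map_zero : map 0 = ContinuousLinearMap.id ℂ A
  map_add : ∀ x y, map (x + y) = (map x).comp (map y)

variable {A Γ}

instance : CoeFun (PosAction A Γ) (fun _ => PosCone Γ → A →L[ℂ] A) := ⟨PosAction.map⟩

/-- The pair `(V, H)` of actions is an interaction. -/
structure IsInteraction (V H : PosAction A Γ) : Prop where
  vhv : ∀ x a, V x (H x (V x a)) = V x a
  hvh : ∀ x a, H x (V x (H x a)) = H x a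
  v_mul : ∀ x a b, (a ∈ Set.range (H x) ∨ b ∈ Set.range (H x)) →
    V x (a * b) = V x a * V x b
  h_mul : ∀ x a b, (a ∈ Set.range (V x) ∨ b ∈ Set.range (V x)) →
    H x (a * b) = H x a * H x b

/-- The pair `(V, H)` of actions is a complete interaction. -/
structure IsCompleteInteraction (V H : PosAction A Γ) : Prop extends IsInteraction V H where
  hv : ∀ x a, H x (V x a) = H x 1 * a * H x 1
  vh : ∀ x a, V x (H x a) = V x 1 * a * V x 1
  comm : ∀ x y, H y 1 * V x 1 = V x 1 * H y 1

/-- A covariant representation `(C, σ, U)` of the action `V`: `σ : A → C` is a unital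
`*`-monomorphism into a unital C⋆-algebra and `U : Γ⁺ → C` is a semigroup homomorphism into
partial isometries, with `σ(𝒱ₓ(a)) = Uₓ σ(a) Uₓ*` and `Uₓ* σ(a) Uₓ ∈ σ(A)`. -/
structure CovariantRep (V : PosAction A Γ) (C : Type w) [CStarAlgebra C] where
  σ : A →⋆ₐ[ℂ] C
  injective : Function.Injective σ
  U : PosCone Γ → C
  map_add : ∀ x y, U (x + y) = U x * U y
  partialIsometry : ∀ x, U x * star (U x) * U x = U x
  cov : ∀ x a, σ (V x a) = U x * σ a * star (U x)
  cov_star : ∀ x a, star (U x) * σ a * U x ∈ Set.range σ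

/-- The action `V` is finely representable if it has a covariant representation. -/
def FinelyRepresentable (V : PosAction A Γ) : Prop :=
  ∃ (C : Type w) (_ : CStarAlgebra C), Nonempty (CovariantRep V C)

end Interactions

/-! ### The `*`-algebra of noncommutative polynomials in the generators -/

section FreeAlg

/-- The generators: a copy of `A`, the symbols `Ûₓ`, and their formal adjoints `Ûₓ*`. -/
inductive Letter (A : Type u) (P : Type v) : Type (max u v)
  | coeff (a : A)
  | isom (x : P)
  | adj (x : P)

/-- The involution on generators: `a ↦ a*` on the copy of `A`, and `Ûₓ ↔ Ûₓ*`. -/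
def Letter.inv {A : Type u} {P : Type v} [Star A] : Letter A P → Letter A P
  | .coeff a => .coeff (star a)
  | .isom x => .adj x
  | .adj x => .isom x

/-- The unital complex algebra freely generated by the letters.  (A copy of `FreeAlgebra`, which
does not inherit the `ℂ`-linear star of the latter.) -/
def FreeStarAlg (A : Type u) (P : Type v) : Type (max u v) := FreeAlgebra ℂ (Letter A P)

namespace FreeStarAlg

variable {A : Type u} {P : Type v}

noncomputable instance : Ring (FreeStarAlg A P) := inferInstanceAs (Ring (FreeAlgebra ℂ _))

noncomputable instance : Algebra ℂ (FreeStarAlg A P) :=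
  inferInstanceAs (Algebra ℂ (FreeAlgebra ℂ _))

/-- A generator, as an element of the free algebra. -/
noncomputable def of (l : Letter A P) : FreeStarAlg A P := FreeAlgebra.ι ℂ l

/-- The copy of `a ∈ A` in the free algebra. -/
noncomputable abbrev coeff (a : A) : FreeStarAlg A P := of (.coeff a)

/-- The generator `Ûₓ` in the free algebra. -/
noncomputable abbrev isom (x : P) : FreeStarAlg A P := of (.isom x)

theorem induction {p : FreeStarAlg A P → Prop}
    (halg : ∀ c : ℂ, p (algebraMap ℂ _ c)) (hof : ∀ l, p (of l))
    (hmul : ∀ a b, p a → p b → p (a * b)) (hadd : ∀ a b, p a → p b → p (a + b)) (a) : p a :=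
  FreeAlgebra.induction ℂ (Letter A P) (motive := p) halg hof hmul hadd a

/-- The algebra homomorphism determined by the images of the generators. -/
noncomputable def lift {B : Type*} [Ring B] [Algebra ℂ B] (f : Letter A P → B) :
    FreeStarAlg A P →ₐ[ℂ] B := FreeAlgebra.lift ℂ f

theorem lift_of {B : Type*} [Ring B] [Algebra ℂ B] (f : Letter A P → B) (l : Letter A P) :
    lift f (of l) = f l := FreeAlgebra.lift_ι_apply f l

variable [Star A]

/-- The conjugate-linear antimultiplicative extension of the involution on generators. -/
noncomputable def revHom : FreeStarAlg A P →+* (FreeStarAlg A P)ᵐᵒᵖ :=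
  letI : Algebra ℂ (FreeStarAlg A P)ᵐᵒᵖ := Algebra.compHom _ (starRingEnd ℂ)
  (lift (fun l : Letter A P => MulOpposite.op (of l.inv))).toRingHom

theorem revHom_of (l : Letter A P) : revHom (of l) = MulOpposite.op (of l.inv) :=
  letI : Algebra ℂ (FreeStarAlg A P)ᵐᵒᵖ := Algebra.compHom _ (starRingEnd ℂ)
  lift_of _ l

theorem revHom_algebraMap (c : ℂ) : revHom (algebraMap ℂ (FreeStarAlg A P) c) =
    MulOpposite.op (algebraMap ℂ (FreeStarAlg A P) (star c)) :=
  letI : Algebra ℂ (FreeStarAlg A P)ᵐᵒᵖ := Algebra.compHom _ (starRingEnd ℂ)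
  (lift (fun l : Letter A P => MulOpposite.op (of l.inv))).commutes c

end FreeStarAlg

variable {A : Type u} {P : Type v} [InvolutiveStar A]

theorem Letter.inv_inv (l : Letter A P) : l.inv.inv = l := by
  cases l <;> simp [Letter.inv]

namespace FreeStarAlg

noncomputable instance : StarRing (FreeStarAlg A P) where
  star a := (revHom a).unop
  star_involutive a := by
    induction a using induction with
    | halg c => simp [revHom_algebraMap]
    | hof l => simp [revHom_of, Letter.inv_inv]
    | hmul a b ha hb => simp_all
    | hadd a b ha hb => simp_all
  star_mul a b := by simp
  star_add a b := by simp

theorem star_of (l : Letter A P) : star (of l) = of l.inv := by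
  change (revHom (of l)).unop = _
  rw [revHom_of]; rfl

theorem star_algebraMap (c : ℂ) : star (algebraMap ℂ (FreeStarAlg A P) c) =
    algebraMap ℂ (FreeStarAlg A P) (star c) := by
  change (revHom (algebraMap ℂ (FreeStarAlg A P) c)).unop = _
  rw [revHom_algebraMap]; rfl

instance : StarModule ℂ (FreeStarAlg A P) where
  star_smul c a := by
    rw [Algebra.smul_def, star_mul, star_algebraMap, ← Algebra.commutes, ← Algebra.smul_def]

end FreeStarAlg

end FreeAlg

/-! ### The crossed product -/

section CrossedProduct

variable {A : Type u} {Γ : Type v} [CStarAlgebra A] [PartialOrder A] [StarOrderedRing A]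
  [AddCommGroup Γ] [LinearOrder Γ] [IsOrderedAddMonoid Γ]

open FreeStarAlg

/-- A C⋆-seminorm on the free `*`-algebra which annihilates the defining relations of the crossed
product and restricts to the norm on the copy of `A`. -/
structure CovSeminorm (V H : PosAction A Γ) extends
    Seminorm ℂ (FreeStarAlg A (PosCone Γ)) where
  mul_le : ∀ s t, toFun (s * t) ≤ toFun s * toFun t
  cstar : ∀ s, toFun (star s * s) = toFun s * toFun s
  norm_coeff : ∀ a : A, toFun (coeff a) = ‖a‖
  coeff_add : ∀ a b : A, toFun (coeff (a + b) - (coeff a + coeff b)) = 0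
  coeff_smul : ∀ (c : ℂ) (a : A), toFun (coeff (c • a) - c • coeff a) = 0
  coeff_mul : ∀ a b : A, toFun (coeff (a * b) - coeff a * coeff b) = 0
  coeff_one : toFun (coeff 1 - 1) = 0
  isom_add : ∀ x y, toFun (isom (x + y) - isom x * isom y) = 0
  partialIsometry : ∀ x, toFun (isom x * star (isom x) * isom x - isom x) = 0
  cov_V : ∀ x a, toFun (coeff (V x a) - isom x * coeff a * star (isom x)) = 0
  cov_H : ∀ x a, toFun (coeff (H x a) - star (isom x) * coeff a * isom x) = 0

noncomputable instance (V H : PosAction A Γ) :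
    CoeFun (CovSeminorm V H) (fun _ => FreeStarAlg A (PosCone Γ) → ℝ) := ⟨fun p => p.toSeminorm⟩

/-- The free `*`-algebra, to be given the largest of the above C⋆-seminorms. -/
def PreCrossed (_V _H : PosAction A Γ) : Type (max u v) := FreeStarAlg A (PosCone Γ)

variable (V H : PosAction A Γ)

namespace CovSeminorm

variable {V H}

theorem nonneg (p : CovSeminorm V H) (s) : 0 ≤ p s := apply_nonneg p.toSeminorm s

theorem congr (p : CovSeminorm V H) {s t} (h : p (s - t) = 0) : p s = p t := by
  have h1 : |p s - p t| ≤ p (s - t) := abs_sub_map_le_sub p.toSeminorm s t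
  rw [h] at h1
  exact sub_eq_zero.1 (abs_nonpos_iff.1 h1)

theorem le_star (p : CovSeminorm V H) (s) : p s ≤ p (star s) := by
  have h1 : p s * p s ≤ p (star s) * p s := by
    exact (p.cstar s).symm.le.trans (p.mul_le _ _)
  rcases (p.nonneg s).eq_or_lt with h | h
  · rw [← h]; exact p.nonneg _
  · exact le_of_mul_le_mul_right h1 h

theorem star_eq (p : CovSeminorm V H) (s) : p (star s) = p s :=
  le_antisymm (by simpa using p.le_star (star s)) (p.le_star s)

theorem bddAbove (s) : BddAbove (Set.range fun p : CovSeminorm V H => p s) := by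
  suffices h : ∃ M, ∀ p : CovSeminorm V H, p s ≤ M by
    obtain ⟨M, hM⟩ := h
    exact ⟨M, by rintro _ ⟨p, rfl⟩; exact hM p⟩
  have hisom : ∀ x, ∃ M, ∀ p : CovSeminorm V H, p (isom x) ≤ M := fun x => by
    refine ⟨‖H x 1‖ + 1, fun p => ?_⟩
    have h1 : p (coeff (H x 1)) = p (star (isom x) * coeff 1 * isom x) := p.congr (p.cov_H x 1)
    have h2 : p (star (isom x) * coeff 1 * isom x) = p (star (isom x) * isom x) := by
      apply p.congr
      have : star (isom x) * coeff (1 : A) * isom x - star (isom x) * isom x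
          = star (isom x) * ((coeff (1 : A) - 1) * isom x) := by noncomm_ring
      rw [this]
      refine le_antisymm ((p.mul_le _ _).trans ?_) (p.nonneg _)
      have h3 : p ((coeff (1 : A) - 1) * isom x) ≤ 0 :=
        (p.mul_le _ _).trans (by
          have h4 : p (coeff (1 : A) - 1) = 0 := p.coeff_one
          exact (by rw [h4, zero_mul] : p (coeff (1 : A) - 1) * p (isom x) = 0).le)
      exact mul_nonpos_of_nonneg_of_nonpos (p.nonneg _) h3
    have h5 : p (star (isom x) * isom x) = p (isom x) * p (isom x) := p.cstar _
    have h6 : p (coeff (H x 1)) = ‖H x 1‖ := p.norm_coeff _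
    nlinarith [p.nonneg (isom x)]
  induction s using induction with
  | halg c =>
    refine ⟨‖c‖ * ‖(1 : A)‖, fun p => ?_⟩
    rw [Algebra.algebraMap_eq_smul_one]
    have h1 : p (coeff (1 : A)) = p 1 := p.congr p.coeff_one
    have h2 : p (coeff (1 : A)) = ‖(1 : A)‖ := p.norm_coeff 1
    have h3 : p (c • (1 : FreeStarAlg A (PosCone Γ))) = ‖c‖ * p 1 :=
      map_smul_eq_mul p.toSeminorm c 1
    rw [h3, ← h1, h2]
  | hof l =>
    cases l with
    | coeff a => exact ⟨‖a‖, fun p => (p.norm_coeff a).le⟩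
    | isom x => exact hisom x
    | adj x =>
      obtain ⟨M, hM⟩ := hisom x
      refine ⟨M, fun p => ?_⟩
      have : (of (.adj x) : FreeStarAlg A (PosCone Γ)) = star (isom x) :=
        (star_of (Letter.isom x)).symm
      rw [this, p.star_eq]; exact hM p
  | hmul a b ha hb =>
    obtain ⟨M, hM⟩ := ha
    obtain ⟨N, hN⟩ := hb
    refine ⟨|M| * N, fun p => (p.mul_le a b).trans ?_⟩
    exact mul_le_mul ((hM p).trans (le_abs_self M)) (hN p) (p.nonneg b) (abs_nonneg M)
  | hadd a b ha hb =>
    obtain ⟨M, hM⟩ := ha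
    obtain ⟨N, hN⟩ := hb
    exact ⟨M + N, fun p => (map_add_le_add p.toSeminorm a b).trans (add_le_add (hM p) (hN p))⟩

end CovSeminorm

namespace PreCrossed

noncomputable instance : Ring (PreCrossed V H) := inferInstanceAs (Ring (FreeStarAlg A _))

noncomputable instance : Algebra ℂ (PreCrossed V H) :=
  inferInstanceAs (Algebra ℂ (FreeStarAlg A _))

noncomputable instance : StarRing (PreCrossed V H) :=
  inferInstanceAs (StarRing (FreeStarAlg A _))

instance : StarModule ℂ (PreCrossed V H) := inferInstanceAs (StarModule ℂ (FreeStarAlg A _))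

/-- The supremum of all the C⋆-seminorms compatible with the relations. -/
noncomputable def supNorm (s : PreCrossed V H) : ℝ := ⨆ p : CovSeminorm V H, p s

variable {V H}

theorem supNorm_nonneg (s : PreCrossed V H) : 0 ≤ supNorm V H s :=
  Real.iSup_nonneg fun p => p.nonneg s

theorem le_supNorm (p : CovSeminorm V H) (s : PreCrossed V H) : p s ≤ supNorm V H s :=
  le_ciSup (CovSeminorm.bddAbove s) p

theorem supNorm_le {s : PreCrossed V H} {M : ℝ} (hM : 0 ≤ M)
    (h : ∀ p : CovSeminorm V H, p s ≤ M) : supNorm V H s ≤ M :=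
  Real.iSup_le h hM

theorem supNorm_cstar (s : PreCrossed V H) :
    supNorm V H s * supNorm V H s ≤ supNorm V H (star s * s) := by
  have h : supNorm V H s ≤ Real.sqrt (supNorm V H (star s * s)) := by
    refine supNorm_le (Real.sqrt_nonneg _) fun p => Real.le_sqrt_of_sq_le ?_
    rw [sq]
    exact (p.cstar s).symm.le.trans (le_supNorm p _)
  calc _ ≤ Real.sqrt (supNorm V H (star s * s)) * Real.sqrt (supNorm V H (star s * s)) :=
        mul_self_le_mul_self (supNorm_nonneg s) h
    _ = _ := Real.mul_self_sqrt (supNorm_nonneg _)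

theorem supNorm_star (s : PreCrossed V H) : supNorm V H (star s) = supNorm V H s :=
  iSup_congr fun p => p.star_eq s

noncomputable instance : SeminormedRing (PreCrossed V H) :=
  RingSeminorm.toSeminormedRing
    { toFun := supNorm V H
      map_zero' := le_antisymm (supNorm_le le_rfl fun p => (map_zero p.toSeminorm).le)
        (supNorm_nonneg _)
      add_le' := fun s t => supNorm_le (add_nonneg (supNorm_nonneg _) (supNorm_nonneg _))
        fun p => (map_add_le_add p.toSeminorm s t).trans
          (add_le_add (le_supNorm p s) (le_supNorm p t))
      neg' := fun s => iSup_congr fun p => map_neg_eq_map p.toSeminorm s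
      mul_le' := fun s t => supNorm_le (mul_nonneg (supNorm_nonneg _) (supNorm_nonneg _))
        fun p => (p.mul_le s t).trans
          (mul_le_mul (le_supNorm p s) (le_supNorm p t) (p.nonneg _) (supNorm_nonneg _)) }

theorem norm_def (s : PreCrossed V H) : ‖s‖ = ⨆ p : CovSeminorm V H, p s := rfl

noncomputable instance : NormedAlgebra ℂ (PreCrossed V H) where
  norm_smul_le c s := supNorm_le (mul_nonneg (norm_nonneg _) (supNorm_nonneg _)) fun p =>
    (map_smul_eq_mul p.toSeminorm c s).le.trans
      (mul_le_mul_of_nonneg_left (le_supNorm p s) (norm_nonneg _))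

instance : NormedStarGroup (PreCrossed V H) := ⟨fun s => (supNorm_star s).le⟩

end PreCrossed

/-- The crossed product `A ⋊_{(V,H)} Γ`: the universal unital C⋆-algebra generated by a copy of
`A` and partial isometries `Ûₓ`, `x ∈ Γ⁺`, subject to `𝒱ₓ(a) = Ûₓ a Ûₓ*`, `ℋₓ(a) = Ûₓ* a Ûₓ`,
`Ûₓ Û_y = Û_{x+y}`.  It is the Hausdorff completion of the free `*`-algebra on the generators in
the largest C⋆-seminorm compatible with the relations. -/
def CrossedProduct : Type (max u v) := UniformSpace.Completion (PreCrossed V H)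

namespace CrossedProduct

open UniformSpace

noncomputable instance : NormedRing (CrossedProduct V H) :=
  inferInstanceAs (NormedRing (Completion (PreCrossed V H)))

instance : CompleteSpace (CrossedProduct V H) :=
  inferInstanceAs (CompleteSpace (Completion (PreCrossed V H)))

noncomputable instance : NormedAlgebra ℂ (CrossedProduct V H) where
  toAlgebra := inferInstanceAs (Algebra ℂ (Completion (PreCrossed V H)))
  norm_smul_le := norm_smul_le (α := ℂ) (β := Completion (PreCrossed V H))

variable {V H}

/-- The canonical map from the free `*`-algebra to its completion. -/
noncomputable def mk : PreCrossed V H →ₐ[ℂ] CrossedProduct V H where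
  toFun s := ((s : PreCrossed V H) : Completion (PreCrossed V H))
  map_one' := Completion.coe_one _
  map_zero' := Completion.coe_zero
  map_mul' := Completion.coe_mul
  map_add' := Completion.coe_add
  commutes' _ := rfl

theorem norm_mk (s : PreCrossed V H) : ‖mk s‖ = ‖s‖ := Completion.norm_coe s

theorem denseRange_mk : DenseRange (mk : PreCrossed V H → CrossedProduct V H) :=
  Completion.denseRange_coe

noncomputable instance : Star (CrossedProduct V H) :=
  ⟨Completion.map (star : PreCrossed V H → PreCrossed V H)⟩

theorem star_mk (s : PreCrossed V H) : star (mk s) = mk (star s) :=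
  Completion.map_coe (starₗᵢ ℂ : PreCrossed V H ≃ₗᵢ⋆[ℂ] PreCrossed V H).isometry.uniformContinuous s

theorem continuous_star' : Continuous (star : CrossedProduct V H → CrossedProduct V H) :=
  Completion.continuous_map

noncomputable instance : StarRing (CrossedProduct V H) where
  star_involutive a := by
    refine denseRange_mk.induction_on a
      (isClosed_eq (continuous_star'.comp continuous_star') continuous_id) fun s => ?_
    simp [star_mk]
  star_mul a b := by
    refine denseRange_mk.induction_on₂ (p := fun a b => star (a * b) = star b * star a)
      (isClosed_eq (continuous_star'.comp continuous_mul)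
        ((continuous_star'.comp continuous_snd).mul (continuous_star'.comp continuous_fst)))
      (fun s t => ?_) a b
    simp [star_mk, ← map_mul]
  star_add a b := by
    refine denseRange_mk.induction_on₂ (p := fun a b => star (a + b) = star a + star b)
      (isClosed_eq (continuous_star'.comp continuous_add)
        ((continuous_star'.comp continuous_fst).add (continuous_star'.comp continuous_snd)))
      (fun s t => ?_) a b
    simp [star_mk, ← map_add]

noncomputable instance : CStarAlgebra (CrossedProduct V H) where
  norm_mul_self_le a := by
    refine denseRange_mk.induction_on a
      (isClosed_le (continuous_norm.mul continuous_norm)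
        (continuous_norm.comp (continuous_star'.mul continuous_id))) fun s => ?_
    rw [star_mk, ← map_mul, norm_mk, norm_mk]
    exact PreCrossed.supNorm_cstar s
  star_smul c a := by
    refine denseRange_mk.induction_on a
      (isClosed_eq (continuous_star'.comp (continuous_const_smul c))
        (continuous_const_smul (star c) |>.comp continuous_star')) fun s => ?_
    rw [← map_smul, star_mk, star_smul, star_mk, ← map_smul]

theorem mk_eq {s t : PreCrossed V H} (h : ∀ p : CovSeminorm V H, p (s - t) = 0) :
    mk s = mk t := by
  rw [← sub_eq_zero, ← map_sub, ← norm_eq_zero, norm_mk, PreCrossed.norm_def]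
  simp [h]

variable (V H)

/-- The canonical `*`-homomorphism from `A` to the crossed product. -/
noncomputable def ofCoeff : A →⋆ₐ[ℂ] CrossedProduct V H :=
  StarAlgHom.mk
    (AlgHom.ofLinearMap
      { toFun := fun a => mk (V := V) (H := H) (coeff a : FreeStarAlg A (PosCone Γ))
        map_add' := fun a b => 
          (mk_eq fun p => p.coeff_add a b).trans (map_add mk _ _)
        map_smul' := fun c a => 
          (mk_eq fun p => p.coeff_smul c a).trans (map_smul mk c _) }
      ((mk_eq fun p => p.coeff_one).trans (map_one mk))
      fun a b => (mk_eq fun p => p.coeff_mul a b).trans (map_mul mk _ _))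
    fun a => (congrArg mk (FreeStarAlg.star_of (Letter.coeff a)).symm).trans
      (star_mk (V := V) (H := H) (coeff a)).symm

/-- The canonical generator `Ûₓ` of the crossed product. -/
noncomputable def gen (x : PosCone Γ) : CrossedProduct V H :=
  mk (V := V) (H := H) (isom x : FreeStarAlg A (PosCone Γ))

end CrossedProduct

end CrossedProduct

end InteractionCrossedProduct

namespace InteractionCrossedProduct

set_option linter.unusedSectionVars false

variable {A : Type u} {Γ : Type v} [CStarAlgebra A] [PartialOrder A] [StarOrderedRing A]
  [AddCommGroup Γ] [LinearOrder Γ] [IsOrderedAddMonoid Γ]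

open FreeStarAlg UniformSpace

/-! The crossed product is the Hausdorff completion of the free `*`-algebra on the generators in the
largest compatible C⋆-seminorm, so symmetries of the relations become symmetries of the algebra.
Multiplying each `Ûₓ` by `λ(x)` and its formal adjoint by the conjugate scalar is such a symmetry.
Both sides of every relation acquire the same unimodular factor, and the copy of `A` is fixed. Hence
a compatible seminorm stays compatible after this substitution (`CovSeminorm.compGauge`), the
supremum does not increase (`norm_gaugePre_le`), and the substitution extends to the completion.
Products of characters go to composites there, so the inverse character supplies the inverse map.

Uniqueness (`starAlgEquiv_ext`) and point-norm continuity (`continuous_dualAction_apply`) both rest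
on two facts: polynomials in the generators are dense, and `*`-automorphisms of a C⋆-algebra are
isometric. -/

theorem FreeStarAlg.algHom_ext {P : Type v} {B : Type*} [Ring B] [Algebra ℂ B]
    {f g : FreeStarAlg A P →ₐ[ℂ] B} (h : ∀ l, f (of l) = g (of l)) (s : FreeStarAlg A P) :
    f s = g s := by
  induction s using FreeStarAlg.induction with
  | halg c => simp
  | hof l => exact h l
  | hmul a b ha hb => simp [ha, hb]
  | hadd a b ha hb => simp [ha, hb]

variable {V H : PosAction A Γ}

/-! ### Uniqueness: automorphisms are determined on generators. -/

namespace CrossedProduct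

theorem continuous_mk : Continuous (mk : PreCrossed V H → CrossedProduct V H) :=
  Completion.continuous_coe _

/-- Injective `*`-homomorphisms of C⋆-algebras are isometric, so density arguments apply to purely
algebraic automorphisms. -/
theorem continuous_starAlgEquiv (f : CrossedProduct V H ≃⋆ₐ[ℂ] CrossedProduct V H) :
    Continuous f := (NonUnitalStarAlgHom.isometry f (EquivLike.injective f)).continuous

/-- A `*`-automorphism of the crossed product is determined by its values on the copy of the
coefficient algebra and on the canonical partial isometries. -/
theorem starAlgEquiv_ext {f g : CrossedProduct V H ≃⋆ₐ[ℂ] CrossedProduct V H}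
    (hcoeff : ∀ a, f (ofCoeff V H a) = g (ofCoeff V H a))
    (hgen : ∀ x, f (gen V H x) = g (gen V H x)) : f = g := by
  refine StarAlgEquiv.ext fun b => ?_
  refine denseRange_mk.induction_on b
    (isClosed_eq (continuous_starAlgEquiv f) (continuous_starAlgEquiv g)) fun s => ?_
  refine algHom_ext (f := (f.toAlgEquiv.toAlgHom.comp mk :))
    (g := (g.toAlgEquiv.toAlgHom.comp mk :)) (fun l => ?_) s
  cases l with
  | coeff a => exact hcoeff a
  | isom x => exact hgen x
  | adj x =>
    -- The formal adjoint letter becomes a genuine adjoint, so star-preservation reduces this case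
    -- to `hgen`.
    have hadj : mk (V := V) (H := H) (of (.adj x) : FreeStarAlg A (PosCone Γ)) =
        star (gen V H x) :=
      (congrArg mk (star_of (Letter.isom x)).symm).trans (star_mk _).symm
    change f (mk _) = g (mk _)
    rw [hadj, map_star, map_star, hgen]

end CrossedProduct

/-! ### Characters evaluated on the positive cone. -/

section Dual

variable [TopologicalSpace Γ]

/-- The value `χ(x)` of a character at an element of the positive cone. -/
noncomputable def charValue (χ : PontryaginDual (Multiplicative Γ)) (x : PosCone Γ) : ℂ :=
  (χ (Multiplicative.ofAdd (x : Γ)) : ℂ)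

theorem charValue_add (χ : PontryaginDual (Multiplicative Γ)) (x y : PosCone Γ) :
    charValue χ (x + y) = charValue χ x * charValue χ y := by
  have h : (Multiplicative.ofAdd ((x + y : PosCone Γ) : Γ)) =
      Multiplicative.ofAdd (x : Γ) * Multiplicative.ofAdd (y : Γ) := rfl
  rw [charValue, h, map_mul, Circle.coe_mul]; rfl

theorem charValue_mul (χ ψ : PontryaginDual (Multiplicative Γ)) (x : PosCone Γ) :
    charValue (χ * ψ) x = charValue χ x * charValue ψ x :=
  Circle.coe_mul _ _

theorem charValue_one (x : PosCone Γ) :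
    charValue (1 : PontryaginDual (Multiplicative Γ)) x = 1 := Circle.coe_one

theorem star_charValue_mul_self (χ : PontryaginDual (Multiplicative Γ)) (x : PosCone Γ) :
    star (charValue χ x) * charValue χ x = 1 := by
  have h : ‖charValue χ x‖ = 1 := Circle.norm_coe _
  have := Complex.conj_mul' (charValue χ x)
  rw [h] at this
  simpa using this

/-- The dual carries the topology induced from the compact-open topology on continuous maps, for
which evaluation at a point is continuous. -/
theorem continuous_charValue (x : PosCone Γ) :
    Continuous fun χ : PontryaginDual (Multiplicative Γ) => charValue χ x := by
  have h : Continuous fun f : C(Multiplicative Γ, Circle) => f (Multiplicative.ofAdd (x : Γ)) :=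
    continuous_eval_const _
  have hχ : Continuous fun χ : PontryaginDual (Multiplicative Γ) =>
      χ (Multiplicative.ofAdd (x : Γ)) :=
    h.comp (ContinuousMonoidHom.isInducing_toContinuousMap (Multiplicative Γ) Circle).continuous
  exact continuous_subtype_val.comp hχ

/-! ### The gauge substitution on the free `*`-algebra. -/

/-- The images of the generators under the gauge automorphism of a character. -/
noncomputable def gaugeLetter (χ : PontryaginDual (Multiplicative Γ)) :
    Letter A (PosCone Γ) → FreeStarAlg A (PosCone Γ)
  | .coeff a => coeff a
  | .isom x => charValue χ x • isom x
  -- The conjugate scalar is forced by compatibility with the involution; see `gaugeFree_star`.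
  | .adj x => star (charValue χ x) • of (.adj x)

/-- The gauge endomorphism of the free algebra attached to a character. -/
noncomputable def gaugeFree (χ : PontryaginDual (Multiplicative Γ)) :
    FreeStarAlg A (PosCone Γ) →ₐ[ℂ] FreeStarAlg A (PosCone Γ) := lift (gaugeLetter χ)

variable (χ ψ : PontryaginDual (Multiplicative Γ))

theorem gaugeFree_coeff (a : A) :
    gaugeFree χ (coeff a) = (coeff a : FreeStarAlg A (PosCone Γ)) := lift_of _ _

theorem gaugeFree_isom (x : PosCone Γ) :
    gaugeFree χ (isom x : FreeStarAlg A (PosCone Γ)) = charValue χ x • isom x := lift_of _ _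

theorem gaugeFree_adj (x : PosCone Γ) : gaugeFree χ (of (.adj x) : FreeStarAlg A (PosCone Γ)) =
    star (charValue χ x) • of (.adj x) := lift_of _ _

theorem gaugeFree_star (s : FreeStarAlg A (PosCone Γ)) :
    gaugeFree χ (star s) = star (gaugeFree χ s) := by
  induction s using FreeStarAlg.induction with
  | halg c => simp [star_algebraMap]
  | hof l =>
    rw [star_of]
    cases l with
    | coeff a => simp only [Letter.inv, gaugeFree_coeff, star_of]
    | isom x => simp only [Letter.inv, gaugeFree_isom, gaugeFree_adj, star_smul, star_of]
    | adj x => simp only [Letter.inv, gaugeFree_isom, gaugeFree_adj, star_smul, star_of, star_star]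
  | hmul a b ha hb => simp [ha, hb]
  | hadd a b ha hb => simp [ha, hb]

theorem gaugeFree_mul_apply (s : FreeStarAlg A (PosCone Γ)) :
    gaugeFree (χ * ψ) s = gaugeFree χ (gaugeFree ψ s) := by
  refine algHom_ext (g := (gaugeFree χ).comp (gaugeFree ψ)) (fun l => ?_) s
  cases l with
  | coeff a => simp [gaugeFree_coeff]
  | isom x => simp [gaugeFree_isom, charValue_mul, smul_smul, mul_comm]
  | adj x => simp [gaugeFree_adj, charValue_mul, smul_smul, mul_comm]

theorem gaugeFree_one_apply (s : FreeStarAlg A (PosCone Γ)) :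
    gaugeFree (1 : PontryaginDual (Multiplicative Γ)) s = s := by
  refine algHom_ext (g := AlgHom.id ℂ _) (fun l => ?_) s
  cases l with
  | coeff a => simp [gaugeFree_coeff]
  | isom x => simp [gaugeFree_isom, charValue_one]
  | adj x => simp [gaugeFree_adj, charValue_one]

/-- Compatible C⋆-seminorms are stable under composition with gauge endomorphisms. -/
noncomputable def CovSeminorm.compGauge (p : CovSeminorm V H) : CovSeminorm V H where
  toSeminorm := p.toSeminorm.comp (gaugeFree χ).toLinearMap
  mul_le s t := by
    change p (gaugeFree χ (s * t)) ≤ p (gaugeFree χ s) * p (gaugeFree χ t)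
    rw [map_mul]; exact p.mul_le _ _
  cstar s := by
    change p (gaugeFree χ (star s * s)) = p (gaugeFree χ s) * p (gaugeFree χ s)
    rw [map_mul, gaugeFree_star]; exact p.cstar _
  norm_coeff a := by
    change p (gaugeFree χ (coeff a)) = _
    rw [gaugeFree_coeff]; exact p.norm_coeff a
  coeff_add a b := by
    change p (gaugeFree χ _) = 0
    simp only [map_sub, map_add, gaugeFree_coeff]; exact p.coeff_add a b
  coeff_smul c a := by
    change p (gaugeFree χ _) = 0
    simp only [map_sub, map_smul, gaugeFree_coeff]; exact p.coeff_smul c a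
  coeff_mul a b := by
    change p (gaugeFree χ _) = 0
    simp only [map_sub, map_mul, gaugeFree_coeff]; exact p.coeff_mul a b
  coeff_one := by
    change p (gaugeFree χ _) = 0
    simp only [map_sub, map_one, gaugeFree_coeff]; exact p.coeff_one
  isom_add x y := by
    change p (gaugeFree χ _) = 0
    -- Multiplicativity of the character gives both terms the same scalar, which homogeneity of the
    -- seminorm pulls out of the vanishing relation.
    simp only [map_sub, map_mul, gaugeFree_isom, charValue_add, smul_mul_smul_comm, ← smul_sub]
    refine (map_smul_eq_mul p.toSeminorm _ _).trans ?_
    exact (congrArg _ (p.isom_add x y)).trans (mul_zero _)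
  partialIsometry x := by
    change p (gaugeFree χ _) = 0
    simp only [map_sub, map_mul, gaugeFree_star, gaugeFree_isom, star_smul, smul_mul_smul_comm]
    -- The adjoint's conjugate scalar cancels one of the two copies of `χ(x)`; the remaining one
    -- matches the scalar on `Ûₓ`.
    rw [mul_comm (charValue χ x) (star _), star_charValue_mul_self, one_mul, ← smul_sub]
    refine (map_smul_eq_mul p.toSeminorm _ _).trans ?_
    exact (congrArg _ (p.partialIsometry x)).trans (mul_zero _)
  cov_V x a := by
    change p (gaugeFree χ _) = 0
    simp only [map_sub, map_mul, gaugeFree_star, gaugeFree_isom, gaugeFree_coeff, star_smul,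
      smul_mul_assoc, mul_smul_comm, smul_smul]
    -- One generator and one adjoint occur, so the scalars cancel entirely, as they must since the
    -- coefficient term is fixed.
    rw [star_charValue_mul_self, one_smul]
    exact p.cov_V x a
  cov_H x a := by
    change p (gaugeFree χ _) = 0
    simp only [map_sub, map_mul, gaugeFree_star, gaugeFree_isom, gaugeFree_coeff, star_smul,
      smul_mul_assoc, mul_smul_comm, smul_smul]
    rw [mul_comm (charValue χ x), star_charValue_mul_self, one_smul]
    exact p.cov_H x a

/-! ### Contractivity and continuity in the universal seminorm. -/

variable (V H) in
/-- The gauge endomorphism, on the free algebra carrying the universal C⋆-seminorm. -/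
noncomputable def gaugePre : PreCrossed V H →ₐ[ℂ] PreCrossed V H := gaugeFree χ

/-- Each seminorm composed with the substitution is again one of those in the supremum defining the
norm. -/
theorem norm_gaugePre_le (s : PreCrossed V H) : ‖gaugePre V H χ s‖ ≤ ‖s‖ :=
  PreCrossed.supNorm_le (PreCrossed.supNorm_nonneg s) fun p =>
    PreCrossed.le_supNorm (p.compGauge χ) s

theorem uniformContinuous_gaugePre : UniformContinuous (gaugePre V H χ) :=
  (AddMonoidHomClass.lipschitz_of_bound (gaugePre V H χ) 1
    fun s => by simpa using norm_gaugePre_le χ s).uniformContinuous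

/-- The gauge action is continuous in the character on polynomials in the generators. -/
theorem continuous_gaugePre_apply (s : PreCrossed V H) :
    Continuous fun χ : PontryaginDual (Multiplicative Γ) => gaugePre V H χ s := by
  induction s using FreeStarAlg.induction with
  | halg c =>
    exact continuous_const.congr fun χ => ((gaugePre V H χ).commutes c).symm
  | hof l =>
    cases l with
    | coeff a => exact continuous_const.congr fun χ => (gaugeFree_coeff χ a).symm
    | isom x =>
      exact ((continuous_charValue x).smul
        (continuous_const (y := (show PreCrossed V H from isom x)))).congr
        fun χ => (gaugeFree_isom χ x).symm
    | adj x =>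
      exact ((continuous_charValue x).star.smul
        (continuous_const (y := (show PreCrossed V H from of (.adj x))))).congr
        fun χ => (gaugeFree_adj χ x).symm
  | hmul a b ha hb =>
    exact (ha.mul hb).congr fun χ => (map_mul (gaugePre V H χ) a b).symm
  | hadd a b ha hb =>
    exact (ha.add hb).congr fun χ => (map_add (gaugePre V H χ) a b).symm

/-! ### The dual action on the completion. -/

namespace CrossedProduct

variable (V H) in
/-- The gauge endomorphism of the crossed product attached to a character. -/
noncomputable def gaugeFun : CrossedProduct V H → CrossedProduct V H :=
  Completion.map (gaugePre V H χ)

theorem continuous_gaugeFun : Continuous (gaugeFun V H χ) := Completion.continuous_map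

theorem gaugeFun_mk (s : PreCrossed V H) : gaugeFun V H χ (mk s) = mk (gaugePre V H χ s) :=
  Completion.map_coe (uniformContinuous_gaugePre χ) s

theorem gaugeFun_mul (χ ψ : PontryaginDual (Multiplicative Γ)) (b : CrossedProduct V H) :
    gaugeFun V H (χ * ψ) b = gaugeFun V H χ (gaugeFun V H ψ b) := by
  refine denseRange_mk.induction_on b (isClosed_eq (continuous_gaugeFun _)
    ((continuous_gaugeFun _).comp (continuous_gaugeFun _))) fun s => ?_
  simp only [gaugeFun_mk]
  exact congrArg mk (gaugeFree_mul_apply χ ψ s)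

theorem gaugeFun_one (b : CrossedProduct V H) :
    gaugeFun V H (1 : PontryaginDual (Multiplicative Γ)) b = b := by
  refine denseRange_mk.induction_on b (isClosed_eq (continuous_gaugeFun _)
    continuous_id) fun s => ?_
  rw [gaugeFun_mk]
  exact congrArg mk (gaugeFree_one_apply s)

variable (V H) in
/-- The gauge automorphism of the crossed product attached to a character. -/
noncomputable def gaugeAut : CrossedProduct V H ≃⋆ₐ[ℂ] CrossedProduct V H where
  toFun := gaugeFun V H χ
  invFun := gaugeFun V H χ⁻¹
  left_inv b := by rw [← gaugeFun_mul, inv_mul_cancel, gaugeFun_one]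
  right_inv b := by rw [← gaugeFun_mul, mul_inv_cancel, gaugeFun_one]
  map_mul' a b := by
    have hc := continuous_gaugeFun (V := V) (H := H) χ
    refine denseRange_mk.induction_on₂ (p := fun a b =>
      gaugeFun V H χ (a * b) = gaugeFun V H χ a * gaugeFun V H χ b)
      (isClosed_eq (hc.comp continuous_mul)
        ((hc.comp continuous_fst).mul (hc.comp continuous_snd))) (fun s t => ?_) a b
    simp only [← map_mul, gaugeFun_mk]
  map_add' a b := by
    have hc := continuous_gaugeFun (V := V) (H := H) χ
    refine denseRange_mk.induction_on₂ (p := fun a b =>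
      gaugeFun V H χ (a + b) = gaugeFun V H χ a + gaugeFun V H χ b)
      (isClosed_eq (hc.comp continuous_add)
        ((hc.comp continuous_fst).add (hc.comp continuous_snd))) (fun s t => ?_) a b
    simp only [← map_add, gaugeFun_mk]
  map_star' b := by
    have hc := continuous_gaugeFun (V := V) (H := H) χ
    refine denseRange_mk.induction_on b (isClosed_eq (hc.comp continuous_star')
      (continuous_star'.comp hc)) fun s => ?_
    simp only [star_mk, gaugeFun_mk]
    exact congrArg mk (gaugeFree_star χ s)
  map_smul' c b := by
    have hc := continuous_gaugeFun (V := V) (H := H) χ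
    refine denseRange_mk.induction_on b (isClosed_eq (hc.comp (continuous_const_smul c))
      (hc.const_smul c)) fun s => ?_
    simp only [← map_smul, gaugeFun_mk]

variable (V H) in
/-- The dual action on the crossed product. -/
noncomputable def dualAction : PontryaginDual (Multiplicative Γ) →*
    (CrossedProduct V H ≃⋆ₐ[ℂ] CrossedProduct V H) where
  toFun χ := gaugeAut V H χ
  map_one' := StarAlgEquiv.ext gaugeFun_one
  map_mul' χ ψ := StarAlgEquiv.ext (gaugeFun_mul χ ψ)

theorem dualAction_ofCoeff (a : A) : dualAction V H χ (ofCoeff V H a) = ofCoeff V H a :=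
  (gaugeFun_mk χ _).trans (congrArg mk (gaugeFree_coeff χ a))

theorem dualAction_gen (x : PosCone Γ) : dualAction V H χ (gen V H x) =
    (χ (Multiplicative.ofAdd (x : Γ)) : ℂ) • gen V H x :=
  (gaugeFun_mk χ _).trans ((congrArg mk (gaugeFree_isom χ x)).trans (map_smul mk _ _))

theorem continuous_dualAction_apply (b : CrossedProduct V H) :
    Continuous fun χ => dualAction V H χ b := by
  have hdense := denseRange_mk (V := V) (H := H)
  -- Approximating `b` by the image of a polynomial `s` makes the orbit map a uniform limit of
  -- continuous ones.
  refine continuous_of_uniform_approx_of_continuous fun u hu => ?_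
  obtain ⟨ε, hε, hεu⟩ := Metric.mem_uniformity_dist.1 hu
  obtain ⟨s, hs⟩ := hdense.exists_dist_lt b hε
  refine ⟨fun χ => dualAction V H χ (mk s), ?_, fun χ => hεu ?_⟩
  · exact (continuous_mk.comp (continuous_gaugePre_apply s)).congr fun χ => (gaugeFun_mk χ s).symm
  -- Isometry turns the distance between the images of `b` and `mk s` into the distance between `b`
  -- and `mk s`, so the bound does not depend on `χ`.
  · rwa [(NonUnitalStarAlgHom.isometry _ (EquivLike.injective (dualAction V H χ))).dist_eq]

end CrossedProduct

end Dual

end InteractionCrossedProduct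

open InteractionCrossedProduct in
theorem corollary5p5 {A : Type u} {Γ : Type v}
    [CStarAlgebra A] [PartialOrder A] [StarOrderedRing A]
    [AddCommGroup Γ] [LinearOrder Γ] [IsOrderedAddMonoid Γ]
    [TopologicalSpace Γ] [DiscreteTopology Γ]
    (V H : PosAction A Γ)
    (hV : FinelyRepresentable.{u, v, w} V) (hVH : IsCompleteInteraction V H) :
    ∃ Φ : PontryaginDual (Multiplicative Γ) →*
        (CrossedProduct V H ≃⋆ₐ[ℂ] CrossedProduct V H),
      (∀ χ, (∀ a : A, Φ χ (CrossedProduct.ofCoeff V H a) = CrossedProduct.ofCoeff V H a) ∧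
        ∀ x : PosCone Γ, Φ χ (CrossedProduct.gen V H x) =
          (χ (Multiplicative.ofAdd (x : Γ)) : ℂ) • CrossedProduct.gen V H x) ∧
      (∀ b : CrossedProduct V H, Continuous fun χ => Φ χ b) ∧
      ∀ Ψ : PontryaginDual (Multiplicative Γ) →*
          (CrossedProduct V H ≃⋆ₐ[ℂ] CrossedProduct V H),
        (∀ χ, (∀ a : A, Ψ χ (CrossedProduct.ofCoeff V H a) = CrossedProduct.ofCoeff V H a) ∧
          ∀ x : PosCone Γ, Ψ χ (CrossedProduct.gen V H x) =
            (χ (Multiplicative.ofAdd (x : Γ)) : ℂ) • CrossedProduct.gen V H x) →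
        Ψ = Φ := by
  -- Uniqueness is settled one character at a time: the prescribed values on generators already
  -- determine each automorphism.
  refine ⟨CrossedProduct.dualAction V H, fun χ => ⟨CrossedProduct.dualAction_ofCoeff χ,
    CrossedProduct.dualAction_gen χ⟩, CrossedProduct.continuous_dualAction_apply,
    fun Ψ hΨ => MonoidHom.ext fun χ => CrossedProduct.starAlgEquiv_ext (fun a => ?_) fun x => ?_⟩
  · rw [(hΨ χ).1, CrossedProduct.dualAction_ofCoeff]
  · rw [(hΨ χ).2, CrossedProduct.dualAction_gen]
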